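/- Let $\Omega\subset\mathbb R^n$ be open and connected with $C^1$ boundary $\Gamma=\partial\Omega$ (not necessarily bounded), and let $\nu(x)$ be the outer unit normal at $x\in\Gamma$. Let $H:\overline\Omega\times\mathbb R^n\to\mathbb R$ be continuous with $H(x,\cdot)$ convex for every $x\in\overline\Omega$ (no coercivity is assumed). Let $\gamma:\Gamma\to\mathbb R^n$ be continuous with $\nu(x)\cdot\gamma(x)>0$ for every $x\in\Gamma$, and let $g:\Gamma\to\mathbb R$ be continuous. Let $U\subset\mathbb R^n$ be open, put $\Omega_U=U\cap\Omega$, $\Gamma_U=U\cap\Gamma$, $\Sigma=U\cap\overline\Omega=\Omega_U\cup\Gamma_U$, and let $f:\Sigma\to\mathbb R$ be continuous. Consider $$H(x,Du)=f(x)\ \text{ in }\Omega_U,\qquad D_\gamma u:=\gamma(x)\cdot Du=g(x)\ \text{ on }\Gamma_U. \tag{1}$$ A function $u:\Sigma\to\mathbb R$ is a (viscosity) subsolution of (1) if it is locally bounded above on $\Sigma$ and, with $u^*$ denoting its upper semicontinuous envelope on $\Sigma$, whenever $x\in\Sigma$, $\phi$ is a $C^1$ function on a neighbourhood of $x$ in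 $\mathbb R^n$ and $u^*-\phi$ has a local maximum relative to $\Sigma$ at $x$, one has $H(x,D\phi(x))\le f(x)$ if $x\in\Omega_U$, and $H(x,D\phi(x))\le f(x)$ or $\gamma(x)\cdot D\phi(x)\le g(x)$ if $x\in\Gamma_U$. **Theorem.** Let $\mathcal S$ be a nonempty family of locally Lipschitz continuous functions on $\Sigma$, each of which is a subsolution of (1). Suppose that $$u(x)=\inf\{v(x):v\in\mathcal S\},\qquad x\in\Sigma,$$ is finite for every $x\in\Sigma$ and that $u$ is continuous on $\Sigma$. Then $u$ is a subsolution of (1). -/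

import Mathlib

open Set Filter Topology

namespace NeumannHJ

/-- The Euclidean space `ℝⁿ`. -/
abbrev E (n : ℕ) : Type := EuclideanSpace ℝ (Fin n)

/-- `ρ` is a local `C¹` defining function of `Ω` at `x`: it is `C¹` near `x`, its gradient does not
vanish at `x`, and near `x` the set `Ω` is `{ρ < 0}` and its boundary is `{ρ = 0}`. -/
structure IsDefiningFunctionAt {n : ℕ} (Ω : Set (E n)) (x : E n) (ρ : E n → ℝ) : Prop where
  contDiffAt : ContDiffAt ℝ 1 ρ x
  gradient_ne_zero : gradient ρ x ≠ 0
  mem_iff : ∀ᶠ y in 𝓝 x, (y ∈ Ω ↔ ρ y < 0)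
  mem_frontier_iff : ∀ᶠ y in 𝓝 x, (y ∈ frontier Ω ↔ ρ y = 0)

/-- `Ω` has `C¹` boundary. -/
def HasC1Boundary {n : ℕ} (Ω : Set (E n)) : Prop :=
  ∀ x ∈ frontier Ω, ∃ ρ : E n → ℝ, IsDefiningFunctionAt Ω x ρ

/-- `ν` is the outer unit normal vector of `Ω` at its boundary point `x`. -/
def IsOuterUnitNormal {n : ℕ} (Ω : Set (E n)) (x ν : E n) : Prop :=
  ∃ ρ : E n → ℝ, IsDefiningFunctionAt Ω x ρ ∧ ν = ‖gradient ρ x‖⁻¹ • gradient ρ x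

/-- The vector field `γ` is oblique to the boundary of `Ω`. -/
def IsOblique {n : ℕ} (Ω : Set (E n)) (γ : E n → E n) : Prop :=
  ∀ x ∈ frontier Ω, ∀ ν : E n, IsOuterUnitNormal Ω x ν → 0 < inner ℝ ν (γ x)

/-- The upper semicontinuous envelope `u^*` of a function on `S` that is locally bounded above:
`u^*(x)` is the limit superior of `u y` as `y → x` in `S` (with `y = x` allowed). -/
noncomputable def uscEnvelope {n : ℕ} (S : Set (E n)) (u : E n → ℝ) (x : E n) : ℝ :=
  limsup u (𝓝[S] x)

/-- Viscosity subsolutions of `H(x, Du) = f` in `U ∩ Ω`, `γ · Du = g` on `U ∩ ∂Ω`.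
The unknown `u` is a function on `U ∩ closure Ω`; its values elsewhere play no role. -/
def IsSubsolution {n : ℕ} (Ω U : Set (E n)) (H : E n → E n → ℝ) (f : E n → ℝ)
    (γ : E n → E n) (g : E n → ℝ) (u : E n → ℝ) : Prop :=
  (∀ x ∈ U ∩ closure Ω, ∃ C : ℝ, ∀ᶠ y in 𝓝[U ∩ closure Ω] x, u y ≤ C) ∧
  ∀ x ∈ U ∩ closure Ω, ∀ φ : E n → ℝ, ContDiffAt ℝ 1 φ x →
    IsLocalMaxOn (fun y => uscEnvelope (U ∩ closure Ω) u y - φ y) (U ∩ closure Ω) x →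
      (x ∈ Ω → H x (gradient φ x) ≤ f x) ∧
      (x ∈ frontier Ω → H x (gradient φ x) ≤ f x ∨ inner ℝ (γ x) (gradient φ x) ≤ g x)

end NeumannHJ

namespace NeumannHJ

/-! Interior superjets of a Lipschitz function are bounded, so without coercivity the equation can
still be frozen: near `x` they lie in the closed convex set `K = {H x ≤ f x + δ}`. A superjet of a
finite minimum then also lies in `K` (`gradient_mem_of_isLocalMax_inf'`): otherwise a hyperplane
separates it from `K`, while the growth bound of each member along the normal passes to the minimum.
This settles finite minima inside `Ω`.

At a boundary point `x` the alternative "`H ≤ f` or `γ · p ≤ g`" is not convex in `p`. If it fails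
for a test gradient `p`, choose `k` between `g x` and `γ x · p`, and replace each member `v` by
`shiftSup`, the supremum of `v (y + s γ x) - k s` over small `s ≥ 0`. An interior jet of this
function is a jet of `v` at a maximizing point (`IsSuperjet.of_shiftSup`); if that point lies on the
boundary, then `s > 0` and the jet has slope at least `k` along `γ x`, so the Hamiltonian inequality
must hold there. Hence all interior jets lie in one convex set. At boundary points the shifted
minimum drops at rate at most `k` along `-γ x`, so test gradients have slope at most `k` along `γ
x`. Both cases contradict the choice of `p`.

A compactness argument on small spheres reduces an infinite family to finite minima. -/

/-! ### Superjets, growth along directions, and finite minima -/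

/-- `p` is a `C¹` superdifferential of `v` at `x` relative to `s`. -/
def IsSuperjet {n : ℕ} (s : Set (E n)) (v : E n → ℝ) (x p : E n) : Prop :=
  ∃ φ : E n → ℝ, ContDiffAt ℝ 1 φ x ∧ IsLocalMaxOn (fun y => v y - φ y) s x ∧ gradient φ x = p

theorem hasGradientAt_of_contDiffAt {n : ℕ} {φ : E n → ℝ} {x : E n} (h : ContDiffAt ℝ 1 φ x) :
    HasGradientAt φ (gradient φ x) x :=
  (h.differentiableAt one_ne_zero).hasGradientAt

theorem le_inner_gradient {n : ℕ} {φ : E n → ℝ} {x p h : E n} {k : ℝ} (hφ : HasGradientAt φ p x)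
    (hk : ∀ᶠ t in 𝓝[>] (0 : ℝ), t * k ≤ φ (x + t • h) - φ x) : k ≤ inner ℝ p h := by
  have h1 : HasDerivAt (fun t : ℝ => φ (x + t • h)) (inner ℝ p h) 0 := by
    have h2 : HasDerivAt (fun t : ℝ => x + t • h) h 0 := by
      simpa using ((hasDerivAt_id (0 : ℝ)).smul_const h).const_add x
    have h3 : HasFDerivAt φ (InnerProductSpace.toDual ℝ (E n) p) (x + (0 : ℝ) • h) := by
      simpa using hφ.hasFDerivAt
    have h4 := h3.comp_hasDerivAt (0 : ℝ) h2
    rwa [InnerProductSpace.toDual_apply_apply] at h4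
  have h4 := (hasDerivWithinAt_iff_tendsto_slope' (self_notMem_Ioi)).1
    (h1.hasDerivWithinAt (s := Ioi 0))
  refine ge_of_tendsto h4 ?_
  filter_upwards [hk, self_mem_nhdsWithin] with t ht ht0
  have ht0 : 0 < t := ht0
  rw [slope_def_field, le_div_iff₀ (by simpa using ht0)]
  simp only [zero_smul, add_zero, sub_zero]
  linarith

theorem contDiff_quadratic {n : ℕ} (A : ℝ) (a : E n) :
    ContDiff ℝ 1 (fun y : E n => A * ‖y - a‖ ^ 2) :=
  contDiff_const.mul ((contDiff_id.sub contDiff_const).norm_sq ℝ)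

theorem hasGradientAt_quadratic {n : ℕ} (A : ℝ) (a x : E n) :
    HasGradientAt (fun y : E n => A * ‖y - a‖ ^ 2) ((2 * A) • (x - a)) x := by
  have h := (((hasFDerivAt_id x).sub_const a).norm_sq).const_mul A
  rw [hasGradientAt_iff_hasFDerivAt]
  refine h.congr_fderiv ?_
  ext y
  simp [mul_assoc, mul_left_comm]

/-- A superjet of a Lipschitz function is bounded in the directions that stay in the domain. -/
theorem IsSuperjet.neg_le_inner {n : ℕ} {s : Set (E n)} {v : E n → ℝ} {x p h : E n} {L : ℝ}
    (hp : IsSuperjet s v x p)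
    (hv : ∀ᶠ y in 𝓝[s] x, v x - v y ≤ L * ‖y - x‖)
    (hs : ∀ᶠ t in 𝓝[>] (0 : ℝ), x + t • h ∈ s) : -(L * ‖h‖) ≤ inner ℝ p h := by
  obtain ⟨φ, hφ, hmax, rfl⟩ := hp
  refine le_inner_gradient (hasGradientAt_of_contDiffAt hφ) ?_
  have h1 : Tendsto (fun t : ℝ => x + t • h) (𝓝[>] 0) (𝓝[s] x) := by
    refine tendsto_nhdsWithin_iff.2 ⟨?_, hs⟩
    have : Continuous (fun t : ℝ => x + t • h) := by fun_prop
    simpa using (this.tendsto 0).mono_left nhdsWithin_le_nhds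
  filter_upwards [h1.eventually hv, h1.eventually hmax, self_mem_nhdsWithin] with t h2 h3 h4
  have h4 : 0 < t := h4
  simp only [add_sub_cancel_left, norm_smul, Real.norm_eq_abs, abs_of_pos h4] at h2
  linarith

/-- If every superjet `p` of `v` satisfies `p · h ≤ c`, then `v` grows by at most `c` along `h`. -/
theorem le_add_of_superjet {n : ℕ} {v : E n → ℝ} {z h : E n} {R c : ℝ} (hR : 0 < R)
    (hv : UpperSemicontinuousOn v (Metric.closedBall z R)) (hh : ‖h‖ ≤ R / 2)
    (hc : ∀ x ∈ Metric.ball z R, ∀ p, IsSuperjet univ v x p → inner ℝ p h ≤ c) :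
    v z ≤ v (z - h) + c := by
  refine le_of_forall_pos_le_add fun η hη => ?_
  set y := z - h with hy
  set e := η / 2 with he
  have he0 : 0 < e := by positivity
  have hyz : ‖y - z‖ ≤ R / 2 := by simpa [hy] using hh
  have hzball : z ∈ Metric.closedBall z R := by simp [hR.le]
  have hyball : y ∈ Metric.closedBall z R := by
    rw [mem_closedBall_iff_norm]; linarith
  obtain ⟨xm, -, hxm⟩ := hv.exists_isMaxOn ⟨z, hzball⟩ (isCompact_closedBall z R)
  -- Comparing the maximum of `G` below with its value at `(z, 1)` bounds the penalty by `Q`; with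
  -- `A = Q / m ^ 2` the maximizer is within `m` of the segment.
  set Q := v xm - v z + |c + e| + 1 with hQ
  have hQ0 : 0 < Q := by
    have := hxm hzball
    simp only [mem_ofPred_eq] at this
    have := abs_nonneg (c + e)
    linarith
  have hnear : ∀ᶠ x in 𝓝[Metric.closedBall z R] y, v x < v y + e := hv y hyball _ (by linarith)
  obtain ⟨d, hd, hnear⟩ := Metric.mem_nhdsWithin_iff.1 hnear
  -- `R / 4` keeps the maximizer in the open ball; `d / 2` puts it where `v < v y + e` when `t = 0`.
  set m := min (R / 4) (d / 2) with hm
  have hm0 : 0 < m := by positivity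
  set A := Q / m ^ 2 with hA
  have hA0 : 0 < A := by positivity
  have hAm : ∀ a : ℝ, 0 ≤ a → A * a ^ 2 ≤ Q → a ≤ m := by
    intro a ha h1
    rw [hA, div_mul_eq_mul_div, div_le_iff₀ (by positivity)] at h1
    have : a ^ 2 ≤ m ^ 2 := le_of_mul_le_mul_left h1 hQ0
    exact (sq_le_sq₀ ha hm0.le).1 this
  let G : E n × ℝ → ℝ := fun q => v q.1 + (-(A * ‖q.1 - (y + q.2 • h)‖ ^ 2) - (c + e) * q.2)
  have hG : UpperSemicontinuousOn G (Metric.closedBall z R ×ˢ Icc (0 : ℝ) 1) := by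
    refine UpperSemicontinuousOn.add ?_ (Continuous.continuousOn (by fun_prop)).upperSemicontinuousOn
    exact hv.comp continuousOn_fst fun q hq => hq.1
  obtain ⟨⟨x, t⟩, ⟨hx, ht⟩, hmax⟩ := hG.exists_isMaxOn ⟨(z, 1), mk_mem_prod hzball (by simp)⟩
    ((isCompact_closedBall z R).prod isCompact_Icc)
  simp only at hx ht
  have h1 : G (z, 1) ≤ G (x, t) := hmax (mk_mem_prod hzball (by simp))
  have hGz : G (z, 1) = v z - (c + e) := by simp [G, hy]; ring
  have hvx : v x ≤ v xm := hxm hx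
  have hGx : G (x, t) = v x - A * ‖x - (y + t • h)‖ ^ 2 - (c + e) * t := by simp only [G]; ring
  have hct : (c + e) * (1 - t) ≤ |c + e| := by
    calc (c + e) * (1 - t) ≤ |c + e| * (1 - t) :=
          mul_le_mul_of_nonneg_right (le_abs_self _) (by linarith [ht.2])
      _ ≤ |c + e| * 1 := mul_le_mul_of_nonneg_left (by linarith [ht.1]) (abs_nonneg _)
      _ = _ := mul_one _
  have hclose : ‖x - (y + t • h)‖ ≤ m := by
    refine hAm _ (norm_nonneg _) ?_
    rw [hGz, hGx] at h1
    linarith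
  -- At `t = 0` the comparison with `(z, 1)` is the claim. If `t > 0`, varying `x` yields a superjet
  -- and decreasing `t` shows that its slope along `h` is at least `c + e`.
  rcases ht.1.eq_or_lt with h0 | h0
  · subst h0
    simp only [zero_smul, add_zero] at hclose
    have : v x < v y + e := hnear ⟨by
      rw [mem_ball_iff_norm]
      have := min_le_right (R / 4) (d / 2)
      linarith, hx⟩
    rw [hGz, hGx] at h1
    have : 0 ≤ A * ‖x - (y + (0 : ℝ) • h)‖ ^ 2 := by positivity
    linarith
  · exfalso
    have hxb : x ∈ Metric.ball z R := by
      rw [mem_ball_iff_norm]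
      have h2 : x - z = (x - (y + t • h)) + -((1 - t) • h) := by
        simp only [hy, sub_smul, one_smul]; abel
      have h3 : ‖(1 - t) • h‖ ≤ R / 2 := by
        rw [norm_smul, Real.norm_eq_abs, abs_of_nonneg (by linarith [ht.2])]
        nlinarith [norm_nonneg h, ht.1, ht.2]
      calc ‖x - z‖ ≤ ‖x - (y + t • h)‖ + ‖(1 - t) • h‖ := by
            rw [h2, ← norm_neg ((1 - t) • h)]; exact norm_add_le _ _
        _ < R := by
          have := min_le_left (R / 4) (d / 2)
          linarith
    have hjet : IsSuperjet univ v x ((2 * A) • (x - (y + t • h))) := by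
      refine ⟨fun w => A * ‖w - (y + t • h)‖ ^ 2, (contDiff_quadratic _ _).contDiffAt, ?_,
        (hasGradientAt_quadratic _ _ _).gradient⟩
      have : ∀ᶠ w in 𝓝 x, w ∈ Metric.closedBall z R :=
        mem_of_superset (Metric.isOpen_ball.mem_nhds hxb) Metric.ball_subset_closedBall
      rw [IsLocalMaxOn, nhdsWithin_univ]
      filter_upwards [this] with w hw
      have h2 : G (w, t) ≤ G (x, t) := hmax ⟨hw, ht⟩
      simp only [G] at h2
      linarith
    have h5 := hc x hxb _ hjet
    have h6 : c + e ≤ inner ℝ ((2 * A) • (x - (y + t • h))) h := by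
      refine le_inner_gradient (hasGradientAt_quadratic A (y + t • h) x) ?_
      filter_upwards [Ioo_mem_nhdsGT h0] with τ hτ
      have h2 : G (x, t - τ) ≤ G (x, t) := hmax ⟨hx, by linarith [hτ.2], by linarith [hτ.1, ht.2]⟩
      have h3 : x + τ • h - (y + t • h) = x - (y + (t - τ) • h) := by module
      simp only [G] at h2
      rw [h3]
      linarith
    linarith

/-- This is where convexity of the Hamiltonian enters. A half-space containing `K` but not `p` gives
every `v i` the same lower growth rate along its normal. The minimum inherits it, being equal to a
single `v i` at each displaced point, and the test function must grow at least as fast. -/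
theorem gradient_mem_of_isLocalMax_inf' {n : ℕ} {ι : Type*} {F : Finset ι} (hF : F.Nonempty)
    {v : ι → E n → ℝ} {z : E n} {K : Set (E n)} (hKconv : Convex ℝ K) (hKcl : IsClosed K)
    {R : ℝ} (hR : 0 < R)
    (hv : ∀ i ∈ F, UpperSemicontinuousOn (v i) (Metric.closedBall z R))
    (hjet : ∀ i ∈ F, ∀ x ∈ Metric.ball z R, ∀ p, IsSuperjet univ (v i) x p → p ∈ K)
    {p : E n} (hp : IsSuperjet univ (fun y => F.inf' hF fun i => v i y) z p) : p ∈ K := by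
  by_contra hpK
  obtain ⟨l, c, hlp, hlK⟩ := geometric_hahn_banach_point_closed hKconv hKcl hpK
  obtain ⟨φ, hφ, hmax, rfl⟩ := hp
  set h : E n := -(InnerProductSpace.toDual ℝ (E n)).symm l with hh
  have hl : ∀ q : E n, inner ℝ q h = -l q := fun q => by
    rw [hh, inner_neg_right, real_inner_comm, InnerProductSpace.toDual_symm_apply]
  have key : c ≤ inner ℝ (gradient φ z) (-h) := by
    refine le_inner_gradient (hasGradientAt_of_contDiffAt hφ) ?_
    rw [IsLocalMaxOn, nhdsWithin_univ] at hmax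
    have h1 : Tendsto (fun t : ℝ => z + t • (-h)) (𝓝[>] 0) (𝓝 z) := by
      have : Continuous (fun t : ℝ => z + t • (-h)) := by fun_prop
      simpa using (this.tendsto 0).mono_left nhdsWithin_le_nhds
    have h2 : Tendsto (fun t : ℝ => ‖t • h‖) (𝓝[>] 0) (𝓝 0) := by
      have : Continuous (fun t : ℝ => ‖t • h‖) := by fun_prop
      simpa using (this.tendsto 0).mono_left nhdsWithin_le_nhds
    filter_upwards [h1.eventually hmax, h2.eventually_le_const (half_pos hR), self_mem_nhdsWithin]
      with t ht1 ht2 ht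
    have ht : 0 < t := ht
    obtain ⟨i, hi, hiw⟩ := F.exists_mem_eq_inf' hF fun i => v i (z + t • (-h))
    have h3 : F.inf' hF (fun i => v i z) ≤ v i z := F.inf'_le _ hi
    have h4 : v i z ≤ v i (z - t • h) + -(t * c) := by
      refine le_add_of_superjet hR (hv i hi) ht2 fun x hx q hq => ?_
      have := hlK q (hjet i hi x hx q hq)
      rw [inner_smul_right, hl]
      nlinarith
    have h5 : z - t • h = z + t • (-h) := by module
    rw [h5] at h4
    simp only [hiw] at ht1
    linarith
  rw [inner_neg_right, hl, neg_neg] at key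
  linarith

/-! ### Geometry of an oblique boundary -/

/-- Interior cone condition along a direction that is oblique to a `C¹` boundary. -/
theorem IsDefiningFunctionAt.exists_cone {n : ℕ} {Ω : Set (E n)} {x γ₀ : E n} {ρ : E n → ℝ}
    (hρ : IsDefiningFunctionAt Ω x ρ) (hγ : 0 < inner ℝ (gradient ρ x) γ₀) :
    ∃ r > 0, ∃ c > 0, ∀ y ∈ closure Ω, y ∈ Metric.ball x r → ∀ t : ℝ, 0 < t → t < r →
      ∀ e : E n, ‖e‖ ≤ c → y - t • (γ₀ + e) ∈ Ω := by
  set a : ℝ := inner ℝ (gradient ρ x) γ₀ with ha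
  set N := ‖gradient ρ x‖ with hN
  -- The perturbation `e` costs at most `a / 4` of the slope `a`, and `κ` below makes the
  -- linearization error at most `t * (a / 4)`. Strict differentiability makes this uniform in the
  -- base point `y`.
  set c := a / (4 * (N + 1)) with hc
  have hN0 : 0 ≤ N := norm_nonneg _
  have hc0 : 0 < c := by positivity
  have hcN : N * c ≤ a / 4 := by
    rw [hc, mul_div_assoc', div_le_div_iff₀ (by positivity) (by positivity)]
    nlinarith
  set B := ‖γ₀‖ + c with hB
  have hB0 : 0 < B := by positivity
  set κ := a / (4 * B) with hκ
  have hκ0 : 0 < κ := by positivity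
  have hκB : κ * B = a / 4 := by rw [hκ]; field_simp
  have hstrict : HasStrictFDerivAt ρ (InnerProductSpace.toDual ℝ (E n) (gradient ρ x)) x := by
    have h1 := hρ.contDiffAt.hasStrictFDerivAt one_ne_zero
    rwa [← (hasGradientAt_of_contDiffAt hρ.contDiffAt).hasFDerivAt.fderiv]
  have h1 := hstrict.isLittleO.bound hκ0
  rw [nhds_prod_eq] at h1
  obtain ⟨V, hV, h1⟩ := mem_prod_self_iff.1 h1
  obtain ⟨d, hd, hball⟩ := Metric.mem_nhds_iff.1
    (inter_mem hV (inter_mem hρ.mem_iff hρ.mem_frontier_iff))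
  set r := d / (1 + B) with hr
  have hr0 : 0 < r := by positivity
  have hrd : r * (1 + B) = d := by rw [hr]; field_simp
  refine ⟨r, hr0, c, hc0, fun y hy hyr t ht htr e he => ?_⟩
  rw [mem_ball_iff_norm] at hyr
  have heB : ‖γ₀ + e‖ ≤ B := (norm_add_le _ _).trans (by linarith)
  set y' := y - t • (γ₀ + e) with hy'
  have hdiff : ‖y' - y‖ ≤ t * B := by
    rw [hy', sub_sub_cancel_left, norm_neg, norm_smul, Real.norm_eq_abs, abs_of_pos ht]
    gcongr
  have hyd : y ∈ Metric.ball x d := by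
    rw [mem_ball_iff_norm]; nlinarith
  have hyd' : y' ∈ Metric.ball x d := by
    rw [mem_ball_iff_norm]
    calc ‖y' - x‖ ≤ ‖y' - y‖ + ‖y - x‖ := norm_sub_le_norm_sub_add_norm_sub _ _ _
      _ < d := by nlinarith
  obtain ⟨hyV, hyi, hyf⟩ := hball hyd
  obtain ⟨hyV', hyi', -⟩ := hball hyd'
  have hρy : ρ y ≤ 0 := by
    rw [closure_eq_self_union_frontier] at hy
    rcases hy with hy | hy
    · exact (hyi.1 hy).le
    · exact (hyf.1 hy).le
  refine hyi'.2 ?_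
  have h2 : ‖ρ y' - ρ y - InnerProductSpace.toDual ℝ (E n) (gradient ρ x) (y' - y)‖ ≤
      κ * ‖y' - y‖ := h1 (mk_mem_prod hyV' hyV)
  simp only [InnerProductSpace.toDual_apply_apply, Real.norm_eq_abs] at h2
  have h3 : inner ℝ (gradient ρ x) (y' - y) = -(t * (a + inner ℝ (gradient ρ x) e)) := by
    rw [hy', sub_sub_cancel_left, inner_neg_right, inner_smul_right, inner_add_right]
  have h4 : -(N * c) ≤ inner ℝ (gradient ρ x) e := by
    have := neg_le_of_abs_le (abs_real_inner_le_norm (gradient ρ x) e)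
    have : N * ‖e‖ ≤ N * c := by gcongr
    linarith
  have h5 : κ * ‖y' - y‖ ≤ t * (a / 4) := by
    rw [← hκB]
    calc κ * ‖y' - y‖ ≤ κ * (t * B) := by gcongr
      _ = _ := by ring
  have h6 := (abs_le.1 h2).2
  have h7 : t * (a / 2) ≤ t * (a + inner ℝ (gradient ρ x) e) := by
    gcongr; linarith
  have h8 : 0 < t * (a / 4) := by positivity
  rw [h3] at h6
  linarith

/-! ### Jet formulation and frozen inequalities -/

/-- The viscosity subsolution inequalities for the superjets of `v` itself. -/
def IsJetSubsolution {n : ℕ} (Ω U : Set (E n)) (H : E n → E n → ℝ) (f : E n → ℝ)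
    (γ : E n → E n) (g : E n → ℝ) (v : E n → ℝ) : Prop :=
  ∀ x ∈ U ∩ closure Ω, ∀ p, IsSuperjet (U ∩ closure Ω) v x p →
    (x ∈ Ω → H x p ≤ f x) ∧ (x ∈ frontier Ω → H x p ≤ f x ∨ inner ℝ (γ x) p ≤ g x)

theorem uscEnvelope_eq {n : ℕ} {s : Set (E n)} {v : E n → ℝ} (hv : ContinuousOn v s) {x : E n}
    (hx : x ∈ s) : uscEnvelope s v x = v x := by
  have : (𝓝[s] x).NeBot := mem_closure_iff_nhdsWithin_neBot.1 (subset_closure hx)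
  exact Tendsto.limsup_eq (hv x hx)

theorem isSubsolution_iff {n : ℕ} {Ω U : Set (E n)} {H : E n → E n → ℝ} {f : E n → ℝ}
    {γ : E n → E n} {g v : E n → ℝ} (hv : ContinuousOn v (U ∩ closure Ω)) :
    IsSubsolution Ω U H f γ g v ↔ IsJetSubsolution Ω U H f γ g v := by
  have hmax : ∀ x ∈ U ∩ closure Ω, ∀ φ : E n → ℝ,
      IsLocalMaxOn (fun y => uscEnvelope (U ∩ closure Ω) v y - φ y) (U ∩ closure Ω) x ↔
        IsLocalMaxOn (fun y => v y - φ y) (U ∩ closure Ω) x := by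
    intro x hx φ
    refine eventually_congr ?_
    filter_upwards [self_mem_nhdsWithin] with y hy
    simp only [uscEnvelope_eq hv hx, uscEnvelope_eq hv hy]
  constructor
  · rintro ⟨-, h⟩ x hx _ ⟨φ, hφ, hm, rfl⟩
    exact h x hx φ hφ ((hmax x hx φ).2 hm)
  · intro h
    refine ⟨fun x hx => ⟨v x + 1, ((hv x hx).eventually_lt_const (lt_add_one _)).mono
      fun _ => le_of_lt⟩, fun x hx φ hφ hm => h x hx _ ⟨φ, hφ, (hmax x hx φ).1 hm, rfl⟩⟩

/-- Freezing the space variable in a Hamilton-Jacobi inequality with bounded momenta. -/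
theorem eventually_freeze {n : ℕ} {s : Set (E n)} {H : E n → E n → ℝ} {f : E n → ℝ}
    (hH : ContinuousOn (fun q : E n × E n => H q.1 q.2) (s ×ˢ univ)) (hf : ContinuousOn f s)
    {x : E n} (hx : x ∈ s) (M : ℝ) {δ : ℝ} (hδ : 0 < δ) :
    ∀ᶠ y in 𝓝 x, y ∈ s → ∀ p, ‖p‖ ≤ M → H y p ≤ f y → H x p ≤ f x + δ := by
  have hG : ContinuousOn (fun q : E n × E n => H q.1 q.2 - f q.1 - (H x q.2 - f x)) (s ×ˢ univ) := by
    refine (hH.sub (hf.comp continuousOn_fst fun q hq => hq.1)).sub (ContinuousOn.sub ?_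
      continuousOn_const)
    exact hH.comp (f := fun q : E n × E n => (x, q.2)) (by fun_prop) fun q _ => ⟨hx, trivial⟩
  have key := (isCompact_closedBall (0 : E n) M).eventually_forall_of_forall_eventually
    (x₀ := x) (P := fun y p => y ∈ s → -δ < H y p - f y - (H x p - f x)) ?_
  · filter_upwards [key] with y hy hys p hp hle
    have := hy p (by simpa using hp) hys
    linarith
  · intro p _
    have h1 := (hG (x, p) ⟨hx, trivial⟩).eventually_const_lt (u := -δ) (by simpa using hδ)
    rw [eventually_nhdsWithin_iff] at h1
    filter_upwards [h1] with q hq hqs using hq ⟨hqs, trivial⟩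

theorem exists_lipschitz_nhds {n : ℕ} {s : Set (E n)} {v : E n → ℝ} (hv : LocallyLipschitzOn s v)
    {x : E n} (hx : x ∈ s) : ∃ L : ℝ, 0 ≤ L ∧ ∃ r > 0, ∀ y ∈ s, y ∈ Metric.ball x r → ∀ y' ∈ s,
      y' ∈ Metric.ball x r → |v y - v y'| ≤ L * ‖y - y'‖ := by
  obtain ⟨L, t, ht, hL⟩ := hv hx
  obtain ⟨r, hr, hrt⟩ := Metric.mem_nhdsWithin_iff.1 ht
  refine ⟨L, L.2, r, hr, fun y hy hyr y' hy' hyr' => ?_⟩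
  have := hL.dist_le_mul y (hrt ⟨hyr, hy⟩) y' (hrt ⟨hyr', hy'⟩)
  rwa [Real.dist_eq, dist_eq_norm] at this

/-- The direction `-p` is admissible at an interior point, so the Lipschitz bound gives `‖p‖ ≤ L`;
bounded momenta allow freezing. -/
theorem eventually_jet_mem {n : ℕ} {Ω U : Set (E n)} {H : E n → E n → ℝ} {f : E n → ℝ}
    {γ : E n → E n} {g v : E n → ℝ} (hΩ : IsOpen Ω) (hU : IsOpen U)
    (hH : ContinuousOn (fun q : E n × E n => H q.1 q.2) (closure Ω ×ˢ univ))
    (hf : ContinuousOn f (U ∩ closure Ω)) (hlip : LocallyLipschitzOn (U ∩ closure Ω) v)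
    (hsub : IsJetSubsolution Ω U H f γ g v) {x : E n} (hx : x ∈ U ∩ closure Ω) {δ : ℝ}
    (hδ : 0 < δ) : ∀ᶠ y in 𝓝 x, y ∈ U ∩ Ω → ∀ p, IsSuperjet (U ∩ closure Ω) v y p →
      H x p ≤ f x + δ := by
  obtain ⟨L, hL, r, hr, hLr⟩ := exists_lipschitz_nhds hlip hx
  filter_upwards [eventually_freeze (hH.mono (prod_mono inter_subset_right Subset.rfl)) hf hx L hδ,
    Metric.ball_mem_nhds x hr] with y hfr hyr hy p hp
  have hyS : y ∈ U ∩ closure Ω := ⟨hy.1, subset_closure hy.2⟩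
  refine hfr hyS p ?_ ((hsub y hyS p hp).1 hy.2)
  have h1 : -(L * ‖-p‖) ≤ inner ℝ p (-p) := by
    refine hp.neg_le_inner ?_ ?_
    · filter_upwards [self_mem_nhdsWithin, mem_nhdsWithin_of_mem_nhds
        (Metric.isOpen_ball.mem_nhds hyr)] with y' h2 h3
      rw [norm_sub_rev]
      exact (le_abs_self _).trans (hLr y hyS hyr y' h2 h3)
    · have h2 : Tendsto (fun t : ℝ => y + t • (-p)) (𝓝[>] 0) (𝓝 y) := by
        have : Continuous (fun t : ℝ => y + t • (-p)) := by fun_prop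
        simpa using (this.tendsto 0).mono_left nhdsWithin_le_nhds
      filter_upwards [h2.eventually ((hU.inter hΩ).mem_nhds hy)] with t ht
      exact ⟨ht.1, subset_closure ht.2⟩
  rw [norm_neg, inner_neg_right, real_inner_self_eq_norm_sq] at h1
  by_contra h2
  push Not at h2
  nlinarith [norm_nonneg p]

/-- Boundary superjets may be unbounded, since adding an inward normal keeps a superjet. The lower
bound `k` on the slope along `γ x` excludes this: the cone of inward directions gives `c ‖p‖ + k ≤ L
(‖γ x‖ + c)`. As `k > g x`, the boundary alternative fails nearby and the Hamiltonian inequality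
remains. -/
theorem eventually_jet_mem_of_frontier {n : ℕ} {Ω U : Set (E n)} {H : E n → E n → ℝ} {f : E n → ℝ}
    {γ : E n → E n} {g v : E n → ℝ} (hU : IsOpen U)
    (hH : ContinuousOn (fun q : E n × E n => H q.1 q.2) (closure Ω ×ˢ univ))
    (hf : ContinuousOn f (U ∩ closure Ω)) (hγ : ContinuousOn γ (frontier Ω))
    (hg : ContinuousOn g (frontier Ω)) (hlip : LocallyLipschitzOn (U ∩ closure Ω) v)
    (hsub : IsJetSubsolution Ω U H f γ g v) {x : E n} (hxU : x ∈ U) (hx : x ∈ frontier Ω)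
    {r c : ℝ} (hr : 0 < r) (hc : 0 < c)
    (hcone : ∀ y ∈ closure Ω, y ∈ Metric.ball x r → ∀ t : ℝ, 0 < t → t < r →
      ∀ e : E n, ‖e‖ ≤ c → y - t • (γ x + e) ∈ Ω)
    {k δ : ℝ} (hk : g x < k) (hδ : 0 < δ) :
    ∀ᶠ y in 𝓝 x, y ∈ U → y ∈ frontier Ω → ∀ p, IsSuperjet (U ∩ closure Ω) v y p →
      k ≤ inner ℝ p (γ x) → H x p ≤ f x + δ := by
  have hxS : x ∈ U ∩ closure Ω := ⟨hxU, frontier_subset_closure hx⟩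
  obtain ⟨L, hL, r', hr', hLr⟩ := exists_lipschitz_nhds hlip hxS
  set M := (L * (‖γ x‖ + c) - k) / c with hM
  set η := (k - g x) / 2 with hη
  have hη0 : 0 < η := by rw [hη]; linarith
  have e1 : ∀ᶠ y in 𝓝 x, y ∈ frontier Ω → g y < g x + η :=
    eventually_nhdsWithin_iff.1 ((hg x hx).eventually_lt_const (by linarith))
  have e2 : ∀ᶠ y in 𝓝 x, y ∈ frontier Ω → ‖γ y - γ x‖ < η / (|M| + 1) := by
    refine eventually_nhdsWithin_iff.1 ?_
    have := ((hγ x hx).sub_const (γ x)).norm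
    refine this.eventually_lt_const ?_
    rw [sub_self, norm_zero]
    positivity
  filter_upwards [eventually_freeze (hH.mono (prod_mono inter_subset_right Subset.rfl)) hf hxS M hδ,
    Metric.ball_mem_nhds x hr, Metric.ball_mem_nhds x hr', e1, e2]
    with y hfr hyr hyr' hgy hγy hyU hy p hp hkp
  have hyS : y ∈ U ∩ closure Ω := ⟨hyU, frontier_subset_closure hy⟩
  have hpM : ‖p‖ ≤ M := by
    -- The vector `e` is `c p / ‖p‖`, or `0` when `p = 0`.
    obtain ⟨e, hec, hep⟩ : ∃ e : E n, ‖e‖ ≤ c ∧ inner ℝ p e = c * ‖p‖ := by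
      refine ⟨(c * ‖p‖⁻¹) • p, ?_, ?_⟩
      · rw [norm_smul, Real.norm_eq_abs, abs_of_nonneg (by positivity), mul_assoc]
        exact mul_le_of_le_one_right hc.le (inv_mul_le_one_of_le₀ le_rfl (norm_nonneg _))
      · rw [inner_smul_right, real_inner_self_eq_norm_sq]
        rcases eq_or_ne ‖p‖ 0 with h0 | h0
        · simp [h0]
        · field_simp
    have h1 : -(L * ‖-(γ x + e)‖) ≤ inner ℝ p (-(γ x + e)) := by
      refine hp.neg_le_inner ?_ ?_
      · filter_upwards [self_mem_nhdsWithin, mem_nhdsWithin_of_mem_nhds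
          (Metric.isOpen_ball.mem_nhds hyr')] with y' h2 h3
        rw [norm_sub_rev]
        exact (le_abs_self _).trans (hLr y hyS hyr' y' h2 h3)
      · have h2 : Tendsto (fun t : ℝ => y + t • (-(γ x + e))) (𝓝[>] 0) (𝓝 y) := by
          have : Continuous (fun t : ℝ => y + t • (-(γ x + e))) := by fun_prop
          simpa using (this.tendsto 0).mono_left nhdsWithin_le_nhds
        filter_upwards [h2.eventually (hU.mem_nhds hyU), Ioo_mem_nhdsGT hr] with t ht ht'
        refine ⟨ht, subset_closure ?_⟩
        have := hcone y hyS.2 hyr t ht'.1 ht'.2 e hec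
        rwa [smul_neg, ← sub_eq_add_neg]
    rw [norm_neg, inner_neg_right, inner_add_right, hep] at h1
    have h2 : L * ‖γ x + e‖ ≤ L * (‖γ x‖ + c) :=
      mul_le_mul_of_nonneg_left ((norm_add_le _ _).trans (by linarith)) hL
    rw [hM, le_div_iff₀ hc]
    linarith
  refine hfr hyS p hpM (((hsub y hyS p hp).2 hy).resolve_right ?_)
  have h3 := neg_le_of_abs_le (abs_real_inner_le_norm (γ y - γ x) p)
  have h4 : ‖γ y - γ x‖ * ‖p‖ ≤ η := by
    have h5 : ‖p‖ ≤ |M| + 1 := by linarith [le_abs_self M]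
    calc ‖γ y - γ x‖ * ‖p‖ ≤ η / (|M| + 1) * (|M| + 1) :=
          mul_le_mul (hγy hy).le h5 (norm_nonneg _) (by positivity)
      _ = η := by field_simp
  rw [inner_sub_left, real_inner_comm p (γ x)] at h3
  have := hgy hy
  push Not
  linarith

theorem IsSuperjet.mono {n : ℕ} {s t : Set (E n)} {v : E n → ℝ} {x p : E n}
    (hp : IsSuperjet t v x p) (hst : s ⊆ t) : IsSuperjet s v x p :=
  let ⟨φ, hφ, hm, h⟩ := hp
  ⟨φ, hφ, hm.on_subset hst, h⟩

theorem IsSuperjet.of_mem_nhds {n : ℕ} {s : Set (E n)} {v : E n → ℝ} {x p : E n}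
    (hp : IsSuperjet s v x p) (hs : s ∈ 𝓝 x) : IsSuperjet univ v x p := by
  obtain ⟨φ, hφ, hm, h⟩ := hp
  refine ⟨φ, hφ, ?_, h⟩
  rw [IsLocalMaxOn, nhdsWithin_univ]
  rwa [IsLocalMaxOn, nhdsWithin_eq_nhds.2 hs] at hm

/-! ### Supremum along the oblique direction -/

/-- The supremum of `v` over the segment of points of `C` reached from `x` along `γ₀` up to
time `ε`, discounted at rate `k`. -/
noncomputable def shiftSup {n : ℕ} (C : Set (E n)) (v : E n → ℝ) (γ₀ : E n) (k ε : ℝ) (x : E n) :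
    ℝ :=
  sSup ((fun s : ℝ => v (x + s • γ₀) - k * s) '' (Icc 0 ε ∩ (fun s : ℝ => x + s • γ₀) ⁻¹' C))

section shiftSup

variable {n : ℕ} {C : Set (E n)} {v : E n → ℝ} {γ₀ : E n} {k ε : ℝ} {x : E n}

theorem isCompact_shiftSup_image (hC : IsCompact C) (hv : ContinuousOn v C) :
    IsCompact ((fun s : ℝ => v (x + s • γ₀) - k * s) ''
      (Icc 0 ε ∩ (fun s : ℝ => x + s • γ₀) ⁻¹' C)) := by
  refine (isCompact_Icc.inter_right (hC.isClosed.preimage (by fun_prop))).image_of_continuousOn ?_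
  refine ContinuousOn.sub ?_ (by fun_prop)
  exact hv.comp (f := fun s : ℝ => x + s • γ₀) (by fun_prop) fun s hs => hs.2

theorem le_shiftSup (hC : IsCompact C) (hv : ContinuousOn v C) {s : ℝ} (hs : s ∈ Icc 0 ε)
    (hx : x + s • γ₀ ∈ C) : v (x + s • γ₀) - k * s ≤ shiftSup C v γ₀ k ε x :=
  le_csSup (isCompact_shiftSup_image hC hv).bddAbove ⟨s, ⟨hs, hx⟩, rfl⟩

theorem exists_shiftSup_eq (hC : IsCompact C) (hv : ContinuousOn v C) (hε : 0 ≤ ε) (hx : x ∈ C) :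
    ∃ s ∈ Icc 0 ε, x + s • γ₀ ∈ C ∧ shiftSup C v γ₀ k ε x = v (x + s • γ₀) - k * s := by
  obtain ⟨s, ⟨hs, hsC⟩, h⟩ := (isCompact_shiftSup_image (γ₀ := γ₀) (k := k) (ε := ε) hC hv).sSup_mem
    ⟨_, 0, ⟨⟨le_rfl, hε⟩, by simpa using hx⟩, rfl⟩
  exact ⟨s, hs, hsC, h.symm⟩

theorem self_le_shiftSup (hC : IsCompact C) (hv : ContinuousOn v C) (hε : 0 ≤ ε) (hx : x ∈ C) :
    v x ≤ shiftSup C v γ₀ k ε x := by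
  simpa using le_shiftSup (γ₀ := γ₀) (k := k) (s := 0) hC hv ⟨le_rfl, hε⟩ (by simpa using hx)

theorem upperSemicontinuousOn_shiftSup (hC : IsCompact C) (hv : ContinuousOn v C) (hε : 0 ≤ ε) :
    UpperSemicontinuousOn (shiftSup C v γ₀ k ε) C := by
  intro x hx a ha
  have key := (isCompact_Icc (a := (0 : ℝ)) (b := ε)).eventually_forall_of_forall_eventually
    (x₀ := x) (P := fun y s => y + s • γ₀ ∈ C → v (y + s • γ₀) - k * s < a) ?_
  · filter_upwards [mem_nhdsWithin_of_mem_nhds key, self_mem_nhdsWithin] with y hy hyC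
    obtain ⟨s, hs, hsC, h⟩ := exists_shiftSup_eq (γ₀ := γ₀) (k := k) hC hv hε hyC
    rw [h]
    exact hy s hs hsC
  · intro s hs
    have hcont : Continuous (fun q : E n × ℝ => q.1 + q.2 • γ₀) := by fun_prop
    by_cases hsC : x + s • γ₀ ∈ C
    · have h1 : ContinuousOn (fun q : E n × ℝ => v (q.1 + q.2 • γ₀) - k * q.2)
          ((fun q : E n × ℝ => q.1 + q.2 • γ₀) ⁻¹' C) :=
        (hv.comp hcont.continuousOn fun q hq => hq).sub (by fun_prop)
      exact eventually_nhdsWithin_iff.1 ((h1 (x, s) hsC).eventually_lt_const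
        ((le_shiftSup hC hv hs hsC).trans_lt ha))
    · filter_upwards [hcont.continuousAt.eventually (hC.isClosed.isOpen_compl.mem_nhds hsC)]
        with q hq h using absurd h hq

theorem eventually_shiftSup_le (hC : IsCompact C) (hv : ContinuousOn v C) {η : ℝ} (hη : 0 < η) :
    ∀ᶠ ε in 𝓝[>] (0 : ℝ), ∀ y ∈ C, shiftSup C v γ₀ k ε y ≤ v y + η := by
  obtain ⟨d, hd, hvd⟩ := Metric.uniformContinuousOn_iff.1
    (hC.uniformContinuousOn_of_continuous hv) (η / 2) (by positivity)
  have e1 : ∀ᶠ ε in 𝓝[>] (0 : ℝ), ε * ‖γ₀‖ < d := by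
    have : Continuous (fun ε : ℝ => ε * ‖γ₀‖) := by fun_prop
    exact mem_nhdsWithin_of_mem_nhds (this.tendsto' 0 0 (by simp) |>.eventually_lt_const hd)
  have e2 : ∀ᶠ ε in 𝓝[>] (0 : ℝ), ε * |k| < η / 2 := by
    have : Continuous (fun ε : ℝ => ε * |k|) := by fun_prop
    exact mem_nhdsWithin_of_mem_nhds
      (this.tendsto' 0 0 (by simp) |>.eventually_lt_const (by positivity))
  filter_upwards [e1, e2, self_mem_nhdsWithin] with ε h1 h2 hε y hy
  obtain ⟨s, hs, hsC, h⟩ := exists_shiftSup_eq (γ₀ := γ₀) (k := k) hC hv (le_of_lt hε) hy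
  rw [h]
  have h3 : |v (y + s • γ₀) - v y| < η / 2 := by
    rw [← Real.dist_eq]
    refine hvd _ hsC _ hy ?_
    rw [dist_eq_norm, add_sub_cancel_left, norm_smul, Real.norm_eq_abs, abs_of_nonneg hs.1]
    exact (mul_le_mul_of_nonneg_right hs.2 (norm_nonneg _)).trans_lt h1
  have h4 : -(k * s) ≤ ε * |k| := by
    calc -(k * s) = s * -k := by ring
      _ ≤ s * |k| := mul_le_mul_of_nonneg_left (neg_le_abs k) hs.1
      _ ≤ ε * |k| := mul_le_mul_of_nonneg_right hs.2 (abs_nonneg k)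
  linarith [(abs_lt.1 h3).2]

/-- Translating the test function moves the contact to the maximizing point. If `s > 0`, the same
point is reached from `x + t • γ₀` in time `s - t`, which saves `k * t` of discount. -/
theorem IsSuperjet.of_shiftSup (hC : IsCompact C) (hv : ContinuousOn v C) {p : E n}
    (hp : IsSuperjet univ (shiftSup C v γ₀ k ε) x p) {s : ℝ} (hs : s ∈ Icc 0 ε)
    (hxs : x + s • γ₀ ∈ C) (heq : shiftSup C v γ₀ k ε x = v (x + s • γ₀) - k * s) {S : Set (E n)}
    (hS : C ∈ 𝓝[S] (x + s • γ₀)) :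
    IsSuperjet S v (x + s • γ₀) p ∧ (0 < s → k ≤ inner ℝ p γ₀) := by
  obtain ⟨φ, hφ, hm, rfl⟩ := hp
  rw [IsLocalMaxOn, nhdsWithin_univ] at hm
  have hsub : x + s • γ₀ - s • γ₀ = x := by abel
  constructor
  · refine ⟨fun y => φ (y - s • γ₀), ?_, ?_, ?_⟩
    · refine ContDiffAt.comp (g := φ) (x + s • γ₀) ?_ (by fun_prop)
      rwa [hsub]
    · have h1 : Tendsto (fun y => y - s • γ₀) (𝓝[S] (x + s • γ₀)) (𝓝 x) := by
        have : Continuous (fun y : E n => y - s • γ₀) := by fun_prop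
        exact (this.tendsto' _ _ hsub).mono_left nhdsWithin_le_nhds
      filter_upwards [h1.eventually hm, hS] with y hy hyC
      have h2 : y - s • γ₀ + s • γ₀ = y := by abel
      have h3 := le_shiftSup (x := y - s • γ₀) (k := k) hC hv hs (by rwa [h2])
      rw [h2] at h3
      rw [hsub]
      rw [heq] at hy
      linarith
    · simp only [gradient, fderiv_comp_sub, hsub]
  · intro hs0
    refine le_inner_gradient (hasGradientAt_of_contDiffAt hφ) ?_
    have h1 : Tendsto (fun t : ℝ => x + t • γ₀) (𝓝[>] 0) (𝓝 x) := by
      have : Continuous (fun t : ℝ => x + t • γ₀) := by fun_prop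
      exact (this.tendsto' _ _ (by simp)).mono_left nhdsWithin_le_nhds
    filter_upwards [h1.eventually hm, Ioo_mem_nhdsGT hs0] with t ht hts
    have h2 : x + t • γ₀ + (s - t) • γ₀ = x + s • γ₀ := by module
    have h3 := le_shiftSup (x := x + t • γ₀) (k := k) (s := s - t) (γ₀ := γ₀) (ε := ε) hC hv
      ⟨by linarith [hts.2], by linarith [hts.1, hs.2]⟩ (by rwa [h2])
    rw [h2] at h3
    rw [heq] at ht
    linarith

end shiftSup

/-! ### Strict test functions and finite minima -/

theorem contDiffAt_add_sq {n : ℕ} {φ : E n → ℝ} {x z : E n} (hφ : ContDiffAt ℝ 1 φ z) :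
    ContDiffAt ℝ 1 (fun y => φ y + ‖y - x‖ ^ 2) z := by
  simpa using hφ.add (contDiff_quadratic 1 x).contDiffAt

theorem gradient_add_sq {n : ℕ} {φ : E n → ℝ} {x : E n} (hφ : ContDiffAt ℝ 1 φ x) :
    gradient (fun y => φ y + ‖y - x‖ ^ 2) x = gradient φ x := by
  have h : HasGradientAt (fun y => φ y + 1 * ‖y - x‖ ^ 2) (gradient φ x + (2 * (1 : ℝ)) • (x - x)) x := by
    rw [hasGradientAt_iff_hasFDerivAt, map_add]
    exact (hasGradientAt_of_contDiffAt hφ).hasFDerivAt.add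
      (hasGradientAt_quadratic 1 x x).hasFDerivAt
  simpa using h.gradient

theorem continuousAt_gradient {n : ℕ} {φ : E n → ℝ} {x : E n} (hφ : ContDiffAt ℝ 1 φ x) :
    ContinuousAt (gradient φ) x :=
  (InnerProductSpace.toDual ℝ (E n)).symm.continuous.continuousAt.comp
    (hφ.fderiv_right (m := 0) (by simp)).continuousAt

theorem upperSemicontinuousOn_inf' {α ι : Type*} [TopologicalSpace α] {F : Finset ι}
    (hF : F.Nonempty) {v : ι → α → ℝ} {s : Set α} (hv : ∀ i ∈ F, UpperSemicontinuousOn (v i) s) :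
    UpperSemicontinuousOn (fun x => F.inf' hF fun i => v i x) s := by
  intro x hx a ha
  obtain ⟨i, hi, h⟩ := F.exists_mem_eq_inf' hF fun i => v i x
  simp only [h] at ha
  filter_upwards [hv i hi x hx a ha] with y hy
  exact (F.inf'_le _ hi).trans_lt hy

section

variable {n : ℕ} {Ω U : Set (E n)} {H : E n → E n → ℝ} {f : E n → ℝ} {γ : E n → E n} {g : E n → ℝ}

theorem isClosed_sublevel_hamiltonian
    (hH : ContinuousOn (fun q : E n × E n => H q.1 q.2) (closure Ω ×ˢ univ)) {x : E n}
    (hx : x ∈ closure Ω) (a : ℝ) : IsClosed {q | H x q ≤ a} :=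
  isClosed_le (continuousOn_univ.1 (hH.comp (f := fun q : E n => (x, q)) (by fun_prop)
    fun _ _ => ⟨hx, trivial⟩)) continuous_const

theorem convex_sublevel_hamiltonian {x : E n} (hH : ConvexOn ℝ univ (H x)) (a : ℝ) :
    Convex ℝ {q | H x q ≤ a} := by
  simpa using hH.convex_le a

theorem inf'_jet_interior (hΩ : IsOpen Ω) (hU : IsOpen U)
    (hH : ContinuousOn (fun q : E n × E n => H q.1 q.2) (closure Ω ×ˢ univ))
    (hconv : ∀ x ∈ closure Ω, ConvexOn ℝ univ (H x)) (hf : ContinuousOn f (U ∩ closure Ω))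
    {F : Finset (E n → ℝ)} (hF : F.Nonempty)
    (hlip : ∀ v ∈ F, LocallyLipschitzOn (U ∩ closure Ω) v)
    (hsub : ∀ v ∈ F, IsJetSubsolution Ω U H f γ g v) {x p : E n} (hxU : x ∈ U) (hx : x ∈ Ω)
    (hp : IsSuperjet (U ∩ closure Ω) (fun y => F.inf' hF fun v => v y) x p) : H x p ≤ f x := by
  refine le_of_forall_pos_le_add fun δ hδ => ?_
  have hxS : x ∈ U ∩ closure Ω := ⟨hxU, subset_closure hx⟩
  have hS : U ∩ Ω ⊆ U ∩ closure Ω := inter_subset_inter_right _ subset_closure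
  have e1 := (eventually_all_finset F).2 fun v hv =>
    eventually_jet_mem hΩ hU hH hf (hlip v hv) (hsub v hv) hxS hδ
  obtain ⟨R, hR, hball⟩ := Metric.nhds_basis_closedBall.mem_iff.1
    (inter_mem ((hU.inter hΩ).mem_nhds ⟨hxU, hx⟩) e1)
  refine gradient_mem_of_isLocalMax_inf' hF (v := fun v => v)
    (convex_sublevel_hamiltonian (hconv x hxS.2) (f x + δ))
    (isClosed_sublevel_hamiltonian hH hxS.2 _) hR ?_ ?_
    (hp.of_mem_nhds (mem_of_superset ((hU.inter hΩ).mem_nhds ⟨hxU, hx⟩) hS))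
  · intro v hv
    exact ((hlip v hv).continuousOn.mono fun y hy => hS (hball hy).1).upperSemicontinuousOn
  · intro v hv y hy q hq
    obtain ⟨h1, h2⟩ := hball (Metric.ball_subset_closedBall hy)
    exact h2 v hv h1 q (hq.mono (subset_univ _))

theorem inf'_jet_frontier (hΩ : IsOpen Ω) (hU : IsOpen U) (hbdry : HasC1Boundary Ω)
    (hH : ContinuousOn (fun q : E n × E n => H q.1 q.2) (closure Ω ×ˢ univ))
    (hconv : ∀ x ∈ closure Ω, ConvexOn ℝ univ (H x))
    (hγ : ContinuousOn γ (frontier Ω)) (hobl : IsOblique Ω γ) (hg : ContinuousOn g (frontier Ω))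
    (hf : ContinuousOn f (U ∩ closure Ω))
    {F : Finset (E n → ℝ)} (hF : F.Nonempty)
    (hlip : ∀ v ∈ F, LocallyLipschitzOn (U ∩ closure Ω) v)
    (hsub : ∀ v ∈ F, IsJetSubsolution Ω U H f γ g v) {x p : E n} (hxU : x ∈ U)
    (hx : x ∈ frontier Ω)
    (hp : IsSuperjet (U ∩ closure Ω) (fun y => F.inf' hF fun v => v y) x p) :
    H x p ≤ f x ∨ inner ℝ (γ x) p ≤ g x := by
  by_contra! hcon
  obtain ⟨hHp, hgp⟩ := hcon
  have hxcl : x ∈ closure Ω := frontier_subset_closure hx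
  have hxS : x ∈ U ∩ closure Ω := ⟨hxU, hxcl⟩
  obtain ⟨ρ, hρ⟩ := hbdry x hx
  have hobl' : 0 < inner ℝ (gradient ρ x) (γ x) := by
    have := hobl x hx _ ⟨ρ, hρ, rfl⟩
    rw [real_inner_smul_left] at this
    exact pos_of_mul_pos_right this (by positivity)
  obtain ⟨r, hr, c, hc, hcone⟩ := hρ.exists_cone hobl'
  obtain ⟨k, hgk, hkp⟩ := exists_between hgp
  obtain ⟨b, hfb, hbp⟩ := exists_between hHp
  have hδ : 0 < b - f x := sub_pos.2 hfb
  have hKcl : IsClosed {q | H x q ≤ b} := isClosed_sublevel_hamiltonian hH hxcl b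
  have hKconv : Convex ℝ {q | H x q ≤ b} := convex_sublevel_hamiltonian (hconv x hxcl) b
  obtain ⟨φ, hφ, hmax, hφp⟩ := hp
  set w : E n → ℝ := fun y => F.inf' hF fun v => v y with hw
  -- The quadratic term makes the maximum strict without changing the gradient at `x`.
  set ψ : E n → ℝ := fun y => φ y + ‖y - x‖ ^ 2 with hψ
  have hψd : ContDiffAt ℝ 1 ψ x := contDiffAt_add_sq hφ
  have hψp : gradient ψ x = p := (gradient_add_sq hφ).trans hφp
  have hgrad : Tendsto (gradient ψ) (𝓝 x) (𝓝 p) := hψp ▸ continuousAt_gradient hψd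
  have e1 : ∀ᶠ y in 𝓝 x, ContDiffAt ℝ 1 ψ y := hψd.eventually (by simp)
  have e2 : ∀ᶠ y in 𝓝 x, ¬ H x (gradient ψ y) ≤ b :=
    hgrad.eventually (hKcl.isOpen_compl.mem_nhds (by simpa using hbp))
  have e3 : ∀ᶠ y in 𝓝 x, k < inner ℝ (γ x) (gradient ψ y) :=
    (tendsto_const_nhds.inner hgrad).eventually_const_lt hkp
  have e4 := (eventually_all_finset F).2 fun v hv =>
    eventually_jet_mem hΩ hU hH hf (hlip v hv) (hsub v hv) hxS hδ
  have e5 := (eventually_all_finset F).2 fun v hv =>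
    eventually_jet_mem_of_frontier hU hH hf hγ hg (hlip v hv) (hsub v hv) hxU hx hr hc hcone hgk hδ
  obtain ⟨R, hR, hball⟩ := Metric.nhds_basis_closedBall.mem_iff.1
    (inter_mem (inter_mem (Metric.ball_mem_nhds x hr) (hU.mem_nhds hxU))
      (inter_mem (inter_mem e1 e2) (inter_mem (inter_mem e3 e4)
        (inter_mem e5 (eventually_nhdsWithin_iff.1 hmax)))))
  set C := closure Ω ∩ Metric.closedBall x R with hCdef
  have hC : IsCompact C := (isCompact_closedBall x R).inter_left isClosed_closure
  have hCS : C ⊆ U ∩ closure Ω := fun y hy => ⟨(hball hy.2).1.2, hy.1⟩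
  have hv : ∀ v ∈ F, ContinuousOn v C := fun v hv => (hlip v hv).continuousOn.mono hCS
  have hxC : x ∈ C := ⟨hxcl, Metric.mem_closedBall_self hR.le⟩
  -- On the sphere of radius `R / 2` the strict gap is `(R / 2) ^ 2`; shifting consumes only half of
  -- it, so the maximizer stays inside.
  have hη : 0 < (R / 2) ^ 2 / 2 := by positivity
  have e6 := (eventually_all_finset F).2 fun v hvF =>
    eventually_shiftSup_le (γ₀ := γ x) (k := k) hC (hv v hvF) hη
  have e7 : ∀ᶠ ε in 𝓝[>] (0 : ℝ), ε * ‖γ x‖ < R / 2 := by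
    have : Continuous (fun ε : ℝ => ε * ‖γ x‖) := by fun_prop
    exact mem_nhdsWithin_of_mem_nhds
      (this.tendsto' 0 0 (by simp) |>.eventually_lt_const (by positivity))
  obtain ⟨ε, hεle, hεR, hεr⟩ := (e6.and (e7.and (Ioo_mem_nhdsGT hr))).exists
  have hε : 0 < ε := hεr.1
  set V : (E n → ℝ) → E n → ℝ := fun v => shiftSup C v (γ x) k ε with hV
  have hVusc : ∀ v ∈ F, UpperSemicontinuousOn (V v) C := fun v hvF =>
    upperSemicontinuousOn_shiftSup hC (hv v hvF) hε.le
  set W : E n → ℝ := fun y => F.inf' hF fun v => V v y with hW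
  set D := closure Ω ∩ Metric.closedBall x (R / 2) with hDdef
  have hDC : D ⊆ C := inter_subset_inter_right _ (Metric.closedBall_subset_closedBall (by linarith))
  have hD : IsCompact D := (isCompact_closedBall x _).inter_left isClosed_closure
  have hxD : x ∈ D := ⟨hxcl, Metric.mem_closedBall_self (by positivity)⟩
  have hψc : ∀ y ∈ D, ContDiffAt ℝ 1 ψ y := fun y hy => (hball (hDC hy).2).2.1.1
  have hψD : ContinuousOn ψ D := fun y hy => (hψc y hy).continuousAt.continuousWithinAt
  obtain ⟨z, hzD, hzmax⟩ := (((upperSemicontinuousOn_inf' hF hVusc).mono hDC).add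
    hψD.neg.upperSemicontinuousOn).exists_isMaxOn ⟨x, hxD⟩ hD
  have hzmax : ∀ y ∈ D, W y - ψ y ≤ W z - ψ z := fun y hy => by
    have h1 : W y + -ψ y ≤ W z + -ψ z := hzmax hy
    linarith
  have hzC := hDC hzD
  have hψx : ψ x = φ x := by simp [hψ]
  have hwW : w x ≤ W x := by
    refine Finset.le_inf' hF _ fun v hvF => (F.inf'_le _ hvF).trans ?_
    exact self_le_shiftSup hC (hv v hvF) hε.le hxC
  have hWw : W z ≤ w z + (R / 2) ^ 2 / 2 := by
    obtain ⟨v, hvF, h⟩ := F.exists_mem_eq_inf' hF fun v => v z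
    calc W z ≤ V v z := F.inf'_le _ hvF
      _ ≤ v z + (R / 2) ^ 2 / 2 := hεle v hvF z hzC
      _ = _ := by rw [hw]; simp only [h]
  have hzR : ‖z - x‖ < R / 2 := by
    refine lt_of_le_of_ne (mem_closedBall_iff_norm.1 hzD.2) fun h => ?_
    have h1 : w z - φ z ≤ w x - φ x := (hball hzC.2).2.2.2.2 (hCS hzC)
    have h2 := hzmax x hxD
    have h3 : ψ z = φ z + (R / 2) ^ 2 := by simp only [hψ, h]
    linarith
  obtain ⟨⟨hzr, -⟩, ⟨hz1, hz2⟩, ⟨hz3, -⟩, -⟩ := hball hzC.2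
  have hzball : Metric.ball x (R / 2) ∈ 𝓝 z :=
    Metric.isOpen_ball.mem_nhds (mem_ball_iff_norm.2 hzR)
  have hz := hzD.1
  rw [closure_eq_self_union_frontier] at hz
  rcases hz with hz | hz
  · refine hz2 (gradient_mem_of_isLocalMax_inf' hF (v := V) (z := z) hKconv hKcl
      (R := ?R) ?hR ?usc ?jet ⟨ψ, hz1, ?max, rfl⟩)
    case max =>
      rw [IsLocalMaxOn, nhdsWithin_univ]
      filter_upwards [hzball, hΩ.mem_nhds hz] with y hy hyΩ
      exact hzmax y ⟨subset_closure hyΩ, Metric.ball_subset_closedBall hy⟩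
    case R => exact (Metric.nhds_basis_closedBall.mem_iff.1
      (inter_mem hzball (hΩ.mem_nhds hz))).choose
    all_goals obtain ⟨hR', hball'⟩ := (Metric.nhds_basis_closedBall.mem_iff.1
      (inter_mem hzball (hΩ.mem_nhds hz))).choose_spec
    case hR => exact hR'
    case usc =>
      exact fun v hvF => (hVusc v hvF).mono fun y hy =>
        hDC ⟨subset_closure (hball' hy).2, Metric.ball_subset_closedBall (hball' hy).1⟩
    case jet =>
      intro v hvF y hy q hq
      obtain ⟨hyR, hyΩ⟩ := hball' (Metric.ball_subset_closedBall hy)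
      have hyC : y ∈ C := hDC ⟨subset_closure hyΩ, Metric.ball_subset_closedBall hyR⟩
      obtain ⟨s, hs, hsC, heq⟩ := exists_shiftSup_eq (γ₀ := γ x) (k := k) hC (hv v hvF) hε.le hyC
      have hsball : y + s • γ x ∈ Metric.ball x R := by
        rw [mem_ball_iff_norm] at hyR ⊢
        have h1 : ‖s • γ x‖ < R / 2 := by
          rw [norm_smul, Real.norm_eq_abs, abs_of_nonneg hs.1]
          exact (mul_le_mul_of_nonneg_right hs.2 (norm_nonneg _)).trans_lt hεR
        calc ‖y + s • γ x - x‖ = ‖(y - x) + s • γ x‖ := by congr 1; abel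
          _ ≤ ‖y - x‖ + ‖s • γ x‖ := norm_add_le _ _
          _ < R := by linarith
      have hnhds : C ∈ 𝓝[U ∩ closure Ω] (y + s • γ x) := by
        filter_upwards [self_mem_nhdsWithin, mem_nhdsWithin_of_mem_nhds
          (Metric.isOpen_ball.mem_nhds hsball)] with y' h1 h2
        exact ⟨h1.2, Metric.ball_subset_closedBall h2⟩
      obtain ⟨hjet, hks⟩ := IsSuperjet.of_shiftSup hC (hv v hvF) hq hs hsC heq hnhds
      obtain ⟨⟨-, hsU⟩, -, ⟨-, hs4⟩, hs5, -⟩ := hball hsC.2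
      have hscl := hsC.1
      rw [closure_eq_self_union_frontier] at hscl
      show H x q ≤ b
      rcases hscl with hsΩ | hsΓ
      · have := hs4 v hvF ⟨hsU, hsΩ⟩ q hjet
        linarith
      · have hs0 : 0 < s := by
          refine lt_of_le_of_ne hs.1 fun h => ?_
          rw [← h, zero_smul, add_zero, hΩ.frontier_eq] at hsΓ
          exact hsΓ.2 hyΩ
        have := hs5 v hvF hsU hsΓ q hjet (hks hs0)
        linarith
  · have key : -k ≤ inner ℝ (gradient ψ z) (-γ x) := by
      refine le_inner_gradient (hasGradientAt_of_contDiffAt hz1) ?_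
      have h1 : Tendsto (fun t : ℝ => z + t • (-γ x)) (𝓝[>] 0) (𝓝 z) := by
        have : Continuous (fun t : ℝ => z + t • (-γ x)) := by fun_prop
        exact (this.tendsto' _ _ (by simp)).mono_left nhdsWithin_le_nhds
      filter_upwards [h1.eventually hzball, Ioo_mem_nhdsGT hε] with t ht1 ht
      have hyΩ : z + t • (-γ x) ∈ Ω := by
        have := hcone z hzD.1 hzr t ht.1 (ht.2.trans hεr.2) 0 (by simpa using hc.le)
        rwa [add_zero, sub_eq_add_neg, ← smul_neg] at this
      have h2 := hzmax _ ⟨subset_closure hyΩ, Metric.ball_subset_closedBall ht1⟩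
      have h3 : W z - k * t ≤ W (z + t • (-γ x)) := by
        refine Finset.le_inf' hF _ fun v hvF => ?_
        have h4 : W z ≤ V v z := F.inf'_le _ hvF
        obtain ⟨s, hs, hsC, heq⟩ := exists_shiftSup_eq (γ₀ := γ x) (k := k) hC (hv v hvF) hε.le hzC
        -- The cone condition puts every point displaced backwards from `closure Ω` in `Ω`, so a
        -- boundary point `z` cannot be one.
        have hs0 : s = 0 := by
          by_contra hne
          have h5 := hcone _ hsC.1 (hball hsC.2).1.1 s (lt_of_le_of_ne hs.1 (Ne.symm hne))
            (hs.2.trans_lt hεr.2) 0 (by simpa using hc.le)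
          rw [add_zero, add_sub_cancel_right] at h5
          rw [hΩ.frontier_eq] at hz
          exact hz.2 h5
        have h6 : V v z = v z := by simpa [hs0] using heq
        have h7 : z + t • (-γ x) + t • γ x = z := by module
        have h8 := le_shiftSup (x := z + t • (-γ x)) (γ₀ := γ x) (k := k) (ε := ε) (s := t) hC
          (hv v hvF) ⟨ht.1.le, ht.2.le⟩ (by rwa [h7])
        rw [h7] at h8
        linarith
      linarith
    rw [inner_neg_right, real_inner_comm] at key
    have : k < inner ℝ (γ x) (gradient ψ z) := hz3
    linarith

theorem isJetSubsolution_inf' (hΩ : IsOpen Ω) (hU : IsOpen U) (hbdry : HasC1Boundary Ω)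
    (hH : ContinuousOn (fun q : E n × E n => H q.1 q.2) (closure Ω ×ˢ univ))
    (hconv : ∀ x ∈ closure Ω, ConvexOn ℝ univ (H x))
    (hγ : ContinuousOn γ (frontier Ω)) (hobl : IsOblique Ω γ) (hg : ContinuousOn g (frontier Ω))
    (hf : ContinuousOn f (U ∩ closure Ω))
    {F : Finset (E n → ℝ)} (hF : F.Nonempty)
    (hlip : ∀ v ∈ F, LocallyLipschitzOn (U ∩ closure Ω) v)
    (hsub : ∀ v ∈ F, IsJetSubsolution Ω U H f γ g v) :
    IsJetSubsolution Ω U H f γ g (fun y => F.inf' hF fun v => v y) := fun _ hx _ hp =>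
  ⟨fun hxΩ => inf'_jet_interior hΩ hU hH hconv hf hF hlip hsub hx.1 hxΩ hp,
    fun hxΓ => inf'_jet_frontier hΩ hU hbdry hH hconv hγ hobl hg hf hF hlip hsub hx.1 hxΓ hp⟩

/-! ### Passage to infinite families -/

/-- If every finite minimum of a family of continuous functions is a subsolution in terms of
superjets, then so is the infimum of the family. -/
theorem isJetSubsolution_of_finset_inf' (hΩ : IsOpen Ω) (hU : IsOpen U)
    (hH : ContinuousOn (fun q : E n × E n => H q.1 q.2) (closure Ω ×ˢ univ))
    (hγ : ContinuousOn γ (frontier Ω)) (hg : ContinuousOn g (frontier Ω))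
    (hf : ContinuousOn f (U ∩ closure Ω)) {S : Set (E n → ℝ)} (hS : S.Nonempty)
    (hcont : ∀ v ∈ S, ContinuousOn v (U ∩ closure Ω))
    (hfin : ∀ F : Finset (E n → ℝ), ∀ hF : F.Nonempty, (∀ v ∈ F, v ∈ S) →
      IsJetSubsolution Ω U H f γ g (fun y => F.inf' hF fun v => v y)) {u : E n → ℝ}
    (hu : ∀ x ∈ U ∩ closure Ω, IsGLB ((fun v : E n → ℝ => v x) '' S) (u x)) :
    IsJetSubsolution Ω U H f γ g u := by
  classical
  intro x hx p hp
  obtain ⟨φ, hφ, hmax, hφp⟩ := hp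
  set ψ : E n → ℝ := fun y => φ y + ‖y - x‖ ^ 2 with hψ
  have hψd : ContDiffAt ℝ 1 ψ x := contDiffAt_add_sq hφ
  have hψp : gradient ψ x = p := (gradient_add_sq hφ).trans hφp
  have hgrad : Tendsto (gradient ψ) (𝓝 x) (𝓝 p) := hψp ▸ continuousAt_gradient hψd
  have e1 : ∀ᶠ y in 𝓝 x, ContDiffAt ℝ 1 ψ y := hψd.eventually (by simp)
  have hψx : ψ x = φ x := by simp [hψ]
  -- Every neighbourhood of `x` contains a contact point of a finite minimum.
  have main : ∀ N ∈ 𝓝 x, ∃ y ∈ N, y ∈ U ∩ closure Ω ∧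
      (y ∈ Ω → H y (gradient ψ y) ≤ f y) ∧
      (y ∈ frontier Ω → H y (gradient ψ y) ≤ f y ∨ inner ℝ (γ y) (gradient ψ y) ≤ g y) := by
    intro N hN
    obtain ⟨R, hR, hball⟩ := Metric.nhds_basis_closedBall.mem_iff.1
      (inter_mem (inter_mem hN (hU.mem_nhds hx.1))
        (inter_mem e1 (eventually_nhdsWithin_iff.1 hmax)))
    set D := closure Ω ∩ Metric.closedBall x R with hDdef
    have hD : IsCompact D := (isCompact_closedBall x R).inter_left isClosed_closure
    have hDS : D ⊆ U ∩ closure Ω := fun y hy => ⟨(hball hy.2).1.2, hy.1⟩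
    have hxD : x ∈ D := ⟨hx.2, Metric.mem_closedBall_self hR.le⟩
    have hψc : ∀ y ∈ D, ContDiffAt ℝ 1 ψ y := fun y hy => (hball hy.2).2.1
    have hψD : ContinuousOn ψ D := fun y hy => (hψc y hy).continuousAt.continuousWithinAt
    have hsphere : IsCompact (D ∩ Metric.sphere x R) := hD.inter_right Metric.isClosed_sphere
    -- As in Dini's theorem: `u - ψ` is below its value at `x` by at least `R ^ 2` on the sphere, so
    -- near each of its points one member is already below, and finitely many suffice.
    have hcover : ∀ y ∈ D ∩ Metric.sphere x R, ∃ v ∈ S,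
        ∀ᶠ y' in 𝓝[D ∩ Metric.sphere x R] y, v y' - ψ y' < u x - ψ x := by
      intro y hy
      have h1 : u y - φ y ≤ u x - φ x := (hball hy.1.2).2.2 (hDS hy.1)
      have h2 : ψ y = φ y + R ^ 2 := by
        simp only [hψ, mem_sphere_iff_norm.1 hy.2]
      have h3 : u y < u x - ψ x + ψ y := by
        have : 0 < R ^ 2 := by positivity
        linarith
      obtain ⟨_, ⟨v, hvS, rfl⟩, -, hv⟩ := (hu y (hDS hy.1)).exists_between h3
      refine ⟨v, hvS, ?_⟩
      have h4 : ContinuousOn (fun y => v y - ψ y) D := ((hcont v hvS).mono hDS).sub hψD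
      exact ((h4 y hy.1).mono inter_subset_left).eventually_lt_const (by
        simp only at hv; linarith)
    choose! V hVS hV using hcover
    obtain ⟨T, hT, hTcov⟩ := hsphere.elim_nhdsWithin_subcover
      (fun y => {y' | V y y' - ψ y' < u x - ψ x}) hV
    obtain ⟨v₀, hv₀⟩ := hS
    -- Inserting `v₀` keeps `F` nonempty even if the covered part of the sphere is empty.
    set F := insert v₀ (T.image V) with hFdef
    have hF : F.Nonempty := Finset.insert_nonempty _ _
    have hFS : ∀ v ∈ F, v ∈ S := by
      intro v hv
      rcases Finset.mem_insert.1 hv with rfl | hv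
      · exact hv₀
      · obtain ⟨y, hy, rfl⟩ := Finset.mem_image.1 hv
        exact hVS y (hT y hy)
    set w : E n → ℝ := fun y => F.inf' hF fun v => v y with hw
    have hwusc : UpperSemicontinuousOn w D := upperSemicontinuousOn_inf' hF fun v hv =>
      ((hcont v (hFS v hv)).mono hDS).upperSemicontinuousOn
    obtain ⟨z, hzD, hzmax⟩ := (hwusc.add hψD.neg.upperSemicontinuousOn).exists_isMaxOn ⟨x, hxD⟩ hD
    have hzmax : ∀ y ∈ D, w y - ψ y ≤ w z - ψ z := fun y hy => by
      have h1 : w y + -ψ y ≤ w z + -ψ z := hzmax hy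
      linarith
    have huw : u x ≤ w x := Finset.le_inf' hF _ fun v hv =>
      (hu x hx).1 ⟨v, hFS v hv, rfl⟩
    have hzR : ‖z - x‖ < R := by
      refine lt_of_le_of_ne (mem_closedBall_iff_norm.1 hzD.2) fun h => ?_
      obtain ⟨y, hyT, hy⟩ := mem_iUnion₂.1 (hTcov ⟨hzD, mem_sphere_iff_norm.2 h⟩)
      have h1 : V y z - ψ z < u x - ψ x := hy
      have h2 : w z ≤ V y z :=
        F.inf'_le _ (Finset.mem_insert_of_mem (Finset.mem_image_of_mem V hyT))
      have h3 := hzmax x hxD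
      linarith
    refine ⟨z, (hball hzD.2).1.1, hDS hzD, hfin F hF hFS z (hDS hzD) _
      ⟨ψ, hψc z hzD, ?_, rfl⟩⟩
    filter_upwards [self_mem_nhdsWithin, mem_nhdsWithin_of_mem_nhds
      (Metric.isOpen_ball.mem_nhds (mem_ball_iff_norm.2 hzR))] with y h1 h2
    exact hzmax y ⟨h1.2, Metric.ball_subset_closedBall h2⟩
  -- A strict violation at `x` persists nearby, whereas `main` finds contact points arbitrarily
  -- close to `x`.
  have hHf : f x < H x p → ∀ᶠ y in 𝓝 x, y ∈ U ∩ closure Ω → f y < H y (gradient ψ y) := by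
    intro hlt
    refine eventually_nhdsWithin_iff.1 ?_
    have h1 : Tendsto (fun y => H y (gradient ψ y)) (𝓝[U ∩ closure Ω] x) (𝓝 (H x p)) := by
      refine Tendsto.comp (g := fun q : E n × E n => H q.1 q.2) (f := fun y => (y, gradient ψ y))
        (hH (x, p) ⟨hx.2, trivial⟩) (tendsto_nhdsWithin_iff.2 ⟨?_, ?_⟩)
      · exact (tendsto_id.prodMk_nhds hgrad).mono_left nhdsWithin_le_nhds
      · filter_upwards [self_mem_nhdsWithin] with y hy using ⟨hy.2, trivial⟩
    exact (hf x hx).eventually_lt h1 hlt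
  constructor
  · intro hxΩ
    by_contra! hlt
    obtain ⟨y, ⟨h1, h2⟩, hyS, h3, -⟩ := main _ (inter_mem (hHf hlt) (hΩ.mem_nhds hxΩ))
    exact (h3 h2).not_gt (h1 hyS)
  · intro hxΓ
    by_contra! hlt
    have e2 : ∀ᶠ y in 𝓝 x, y ∈ frontier Ω → g y < inner ℝ (γ y) (gradient ψ y) :=
      eventually_nhdsWithin_iff.1 (Tendsto.eventually_lt (hg x hxΓ)
        (Tendsto.inner (hγ x hxΓ) (hgrad.mono_left nhdsWithin_le_nhds)) hlt.2)
    obtain ⟨y, ⟨h1, h2⟩, hyS, h3, h4⟩ := main _ (inter_mem (hHf hlt.1) e2)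
    have hycl := hyS.2
    rw [closure_eq_self_union_frontier] at hycl
    rcases hycl with hy | hy
    · exact (h3 hy).not_gt (h1 hyS)
    · rcases h4 hy with h | h
      · exact h.not_gt (h1 hyS)
      · exact h.not_gt (h2 hy)

end

end NeumannHJ

theorem theorem2p1 (n : ℕ) (Ω U : Set (NeumannHJ.E n))
    (hΩ_open : IsOpen Ω) (hΩ_conn : IsConnected Ω) (hΩ_bdry : NeumannHJ.HasC1Boundary Ω)
    (hU : IsOpen U)
    (H : NeumannHJ.E n → NeumannHJ.E n → ℝ)
    (hH_cont : ContinuousOn (fun q : NeumannHJ.E n × NeumannHJ.E n => H q.1 q.2)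
      (closure Ω ×ˢ univ))
    (hH_conv : ∀ x ∈ closure Ω, ConvexOn ℝ univ (H x))
    (γ : NeumannHJ.E n → NeumannHJ.E n) (hγ_cont : ContinuousOn γ (frontier Ω))
    (hγ_obl : NeumannHJ.IsOblique Ω γ)
    (g : NeumannHJ.E n → ℝ) (hg : ContinuousOn g (frontier Ω))
    (f : NeumannHJ.E n → ℝ) (hf : ContinuousOn f (U ∩ closure Ω))
    (S : Set (NeumannHJ.E n → ℝ)) (hS_ne : S.Nonempty)
    (hS_lip : ∀ v ∈ S, LocallyLipschitzOn (U ∩ closure Ω) v)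
    (hS_sub : ∀ v ∈ S, NeumannHJ.IsSubsolution Ω U H f γ g v)
    (u : NeumannHJ.E n → ℝ)
    (hu_inf : ∀ x ∈ U ∩ closure Ω, IsGLB ((fun v : NeumannHJ.E n → ℝ => v x) '' S) (u x))
    (hu_cont : ContinuousOn u (U ∩ closure Ω)) :
    NeumannHJ.IsSubsolution Ω U H f γ g u := by
  have hcont : ∀ v ∈ S, ContinuousOn v (U ∩ closure Ω) := fun v hv => (hS_lip v hv).continuousOn
  refine (NeumannHJ.isSubsolution_iff hu_cont).2 ?_
  refine NeumannHJ.isJetSubsolution_of_finset_inf' hΩ_open hU hH_cont hγ_cont hg hf hS_ne hcont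
    (fun F hF hFS => ?_) hu_inf
  exact NeumannHJ.isJetSubsolution_inf' hΩ_open hU hΩ_bdry hH_cont hH_conv hγ_cont hγ_obl hg hf hF
    (fun v hv => hS_lip v (hFS v hv)) fun v hv =>
      (NeumannHJ.isSubsolution_iff (hcont v (hFS v hv))).1 (hS_sub v (hFS v hv))
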